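/- Let $M$ be a smooth $m$-dimensional manifold and $\mathbf{T}M=TM\oplus T^*M$, with the neutral metric $g((X,\alpha),(Y,\mu))=\alpha(Y)+\mu(X)$ and the Courant bracket $$[(X,\alpha),(Y,\mu)]=\bigl([X,Y],\;L_X\mu-L_Y\alpha+\tfrac12 d(\alpha(Y)-\mu(X))\bigr).$$ Let $G$ be a generalized Riemannian metric on $M$, i.e. $G(\mathcal{X},\mathcal{Y})=g(\phi\mathcal{X},\mathcal{Y})$ is positive definite for a smooth endomorphism $\phi$ of $\mathbf{T}M$ with $\phi^2=Id$ and $g(\phi\mathcal{X},\phi\mathcal{Y})=g(\mathcal{X},\mathcal{Y})$. Let $\tau$ be a generalized 2-nilpotent structure, i.e. a smooth endomorphism of $\mathbf{T}M$ of constant rank with $\tau^2=0$ and $g(\mathcal{X},\tau\mathcal{Y})+g(\tau\mathcal{X},\mathcal{Y})=0$, and put $E=\mathrm{im}\,\tau$. Assume that $(G,\tau)$ is a generalized metric 2-nilpotent structure, i.e. $G(\tau\mathcal{X},\tau\mathcal{Y})=G(\mathcal{X},\mathcal{Y})$ for all $\mathcal{X},\mathcal{Y}\in\phi(E)$, and that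 $\tau$ is integrable, i.e. $$[\tau\mathcal{X},\tau\mathcal{Y}]-\tau[\mathcal{X},\tau\mathcal{Y}]-\tau[\tau\mathcal{X},\mathcal{Y}]+\tau^2[\mathcal{X},\mathcal{Y}]=0\qquad\forall\,\mathcal{X},\mathcal{Y}\in\Gamma\mathbf{T}M.$$ Let $\lambda=\tau\circ\phi:E\to E$, which is a complex structure on $E$. Call $D:\Gamma E\times\Gamma E\to\Gamma E$ an $E$-connection if it is additive in both arguments and, for all smooth functions $f$, $D_{fa}b=fD_ab$ and $D_a(fb)=fD_ab+(pr_{TM}a)(f)\,b$. Then $(E,G|_E)$ has a unique Levi-Civita $E$-connection $D^E$, i.e. a unique $E$-connection with $$(pr_{TM}a)(G(b,c))=G(D^E_ab,c)+G(b,D^E_ac),\qquad D^E_ab-D^E_ba=[a,b]\qquad\forall\,a,b,c\in\Gamma E.$$ Moreover, $(G,\tau)$ is of Kähler type, i.e. the $E$-Nijenhuis tensor $$[\lambda a,\lambda b]-\lambda[a,\lambda b]-\lambda[\lambda a,b]+\lambda^2[a,b]\qquad(a,b\in\Gamma E)$$ vanishes, if and only if $D^E_a\lambda=0$ for all $a\in\Gamma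 E$, i.e. $D^E_a(\lambda b)=\lambda(D^E_ab)$ for all $a,b\in\Gamma E$. -/

import Mathlib

open scoped Manifold ContDiff

/-! # The big tangent bundle, the Courant bracket and metric 2-nilpotent structures

`M` is a smooth manifold of dimension `m` (without boundary), modelled on `ℝᵐ`. Smooth sections of
vector bundles are Mathlib's `ContMDiffSection`s of order `∞`. -/

noncomputable section

namespace BigTangent

section Bundles

variable (m : ℕ) (M : Type*) [TopologicalSpace M] [ChartedSpace (EuclideanSpace ℝ (Fin m)) M]

/-- The model fibre `ℝᵐ` of `TM`. -/
abbrev Model : Type := EuclideanSpace ℝ (Fin m)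

/-- The model fibre of `T*M`. -/
abbrev CoModel : Type := Model m →L[ℝ] ℝ

/-- The model fibre of `𝐓M = TM ⊕ T*M`. -/
abbrev BigModel : Type := Model m × CoModel m

/-- The cotangent bundle `T*M`: its fibre at `x` is the dual of `T_x M`. -/
abbrev Cotangent (x : M) : Type := TangentSpace (𝓡 m) x →L[ℝ] Bundle.Trivial M ℝ x

/-- The big tangent bundle `𝐓M = TM ⊕ T*M`. -/
abbrev Big (x : M) : Type := TangentSpace (𝓡 m) x × Cotangent m M x

instance instContinuousAddBig (x : M) : ContinuousAdd (Big m M x) :=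
  inferInstanceAs (ContinuousAdd (TangentSpace (𝓡 m) x × Cotangent m M x))

instance instIsTopologicalAddGroupBig (x : M) : IsTopologicalAddGroup (Big m M x) :=
  inferInstanceAs (IsTopologicalAddGroup (TangentSpace (𝓡 m) x × Cotangent m M x))

instance instContinuousSMulBig (x : M) : ContinuousSMul ℝ (Big m M x) :=
  inferInstanceAs (ContinuousSMul ℝ (TangentSpace (𝓡 m) x × Cotangent m M x))

variable [IsManifold (𝓡 m) ∞ M]

/-- Smooth vector fields. -/
abbrev VField := ContMDiffSection (𝓡 m) (Model m) ∞ (TangentSpace (𝓡 m) : M → Type)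

/-- Smooth differential 1-forms. -/
abbrev OneForm := ContMDiffSection (𝓡 m) (CoModel m) ∞ (Cotangent m M)

/-- `Γ(𝐓M)`: smooth sections of the big tangent bundle. -/
abbrev Sec := ContMDiffSection (𝓡 m) (BigModel m) ∞ (Big m M)

/-- `End(𝐓M)`: smooth sections of the bundle of endomorphisms of the big tangent bundle. -/
abbrev EndBig := ContMDiffSection (𝓡 m) (BigModel m →L[ℝ] BigModel m) ∞
  (fun x : M => Big m M x →L[ℝ] Big m M x)

end Bundles

variable {m : ℕ} {M : Type*} [TopologicalSpace M] [ChartedSpace (EuclideanSpace ℝ (Fin m)) M]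

/-- The neutral metric `g((X,α),(Y,μ)) = α(Y) + μ(X)` on the fibre of `𝐓M` at `x`. -/
def g {x : M} (u v : Big m M x) : ℝ := u.2 v.1 + v.2 u.1

variable [IsManifold (𝓡 m) ∞ M]

/-- The component `pr_{TM} 𝒳` of a section `𝒳` of `𝐓M`. -/
def vec (𝒳 : Sec m M) : VField m M where
  toFun x := (𝒳 x).1
  contMDiff_toFun := by
    intro x
    have h := 𝒳.contMDiff x
    rw [Bundle.contMDiffAt_section] at h ⊢
    exact (contDiff_fst (𝕜 := ℝ) (E := Model m) (F := CoModel m)).contMDiff.contMDiffAt.comp x h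

/-- The component `pr_{T*M} 𝒳` of a section `𝒳` of `𝐓M`. -/
def form (𝒳 : Sec m M) : OneForm m M where
  toFun x := (𝒳 x).2
  contMDiff_toFun := by
    intro x
    have h := 𝒳.contMDiff x
    rw [Bundle.contMDiffAt_section] at h ⊢
    exact (contDiff_snd (𝕜 := ℝ) (E := Model m) (F := CoModel m)).contMDiff.contMDiffAt.comp x h

/-- The section `Ψ𝒳` for an endomorphism `Ψ` of `𝐓M` and a section `𝒳`. -/
def app (Ψ : EndBig m M) (𝒳 : Sec m M) : Sec m M where
  toFun x := Ψ x (𝒳 x)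
  contMDiff_toFun := Ψ.contMDiff.clm_bundle_apply 𝒳.contMDiff

/-- `v(f)`, the derivative at `x` of the function `f` along the tangent vector `v`. -/
def dirDeriv (f : M → ℝ) {x : M} (v : TangentSpace (𝓡 m) x) : ℝ := mvfderiv (𝓡 m) f x v

/-- The operator `Z ↦ X(μ(Z)) - μ([X,Z])` at the point `x`. -/
def lieDerivAux (X : VField m M) (μ : OneForm m M) (x : M)
    (Z : ∀ y : M, TangentSpace (𝓡 m) y) : ℝ :=
  dirDeriv (fun y => μ y (Z y)) (X x) - μ x (VectorField.mlieBracket (𝓡 m) X Z x)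

theorem mdifferentiableAt_pair (μ : OneForm m M) {x : M} {Z : ∀ y : M, TangentSpace (𝓡 m) y}
    (hZ : MDifferentiableAt (𝓡 m) ((𝓡 m).prod 𝓘(ℝ, Model m))
      (fun y => Bundle.TotalSpace.mk' (Model m) y (Z y)) x) :
    MDifferentiableAt (𝓡 m) 𝓘(ℝ, ℝ) (fun y => (μ y (Z y) : ℝ)) x := by
  have h := (μ.contMDiff.mdifferentiable (by simp) x).clm_bundle_apply hZ
  rw [mdifferentiableAt_totalSpace] at h
  exact h.2

/-- `Z ↦ X(μ(Z)) - μ([X,Z])` is tensorial in `Z`. -/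
theorem lieDerivAux_tensorial (X : VField m M) (μ : OneForm m M) (x : M) :
    TensorialAt (𝓡 m) (Model m) (lieDerivAux X μ x) x where
  smul {f Z} hf hZ := by
    have h := mvfderiv_smul hf (mdifferentiableAt_pair μ hZ)
    have e : (fun y => (μ y ((f • Z) y) : ℝ)) = f • (fun y => (μ y (Z y) : ℝ)) := by
      funext y
      exact (μ y).map_smul (f y) (Z y)
    simp only [lieDerivAux, dirDeriv]
    rw [VectorField.mlieBracket_smul_right hf hZ]
    erw [e, h]
    simp
    ring
  add {Z Z'} hZ hZ' := by
    have h := mvfderiv_add (mdifferentiableAt_pair μ hZ) (mdifferentiableAt_pair μ hZ')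
    have e : (fun y => (μ y ((Z + Z') y) : ℝ)) =
        (fun y => (μ y (Z y) : ℝ)) + (fun y => (μ y (Z' y) : ℝ)) := by
      funext y
      exact (μ y).map_add (Z y) (Z' y)
    simp only [lieDerivAux, dirDeriv]
    rw [VectorField.mlieBracket_add_right hZ hZ']
    erw [e, h]
    simp
    ring

/-- The Lie derivative `L_X μ` of a 1-form, `(L_X μ)(Z) = X(μ(Z)) - μ([X,Z])`. -/
def lieDeriv (X : VField m M) (μ : OneForm m M) (x : M) : Cotangent m M x :=
  TensorialAt.mkHom (lieDerivAux X μ x) x (lieDerivAux_tensorial X μ x)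

/-- The Courant bracket
`[(X,α),(Y,μ)] = ([X,Y], L_X μ - L_Y α + ½ d(α(Y) - μ(X)))`, as a field of elements of `𝐓M`. -/
def courant (𝒳 𝒴 : Sec m M) (x : M) : Big m M x :=
  (VectorField.mlieBracket (𝓡 m) (vec 𝒳) (vec 𝒴) x,
    lieDeriv (vec 𝒳) (form 𝒴) x - lieDeriv (vec 𝒴) (form 𝒳) x +
      (1 / 2 : ℝ) • mvfderiv (𝓡 m) (fun y => (𝒳 y).2 (𝒴 y).1 - (𝒴 y).2 (𝒳 y).1 : M → ℝ) x)

/-- The Courant-Nijenhuis torsion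
`N_Ψ(𝒳,𝒴) = [Ψ𝒳,Ψ𝒴] - Ψ[𝒳,Ψ𝒴] - Ψ[Ψ𝒳,𝒴] + Ψ²[𝒳,𝒴]` of an endomorphism of `𝐓M`. -/
def courantNijenhuis (Ψ : EndBig m M) (𝒳 𝒴 : Sec m M) (x : M) : Big m M x :=
  courant (app Ψ 𝒳) (app Ψ 𝒴) x - Ψ x (courant 𝒳 (app Ψ 𝒴) x)
    - Ψ x (courant (app Ψ 𝒳) 𝒴 x) + Ψ x (Ψ x (courant 𝒳 𝒴 x))

variable (m M) in
/-- A generalized Riemannian metric, given by the endomorphism `φ` of `𝐓M` with `φ² = Id`,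
`g(φ𝒳,φ𝒴) = g(𝒳,𝒴)` and such that `G(𝒳,𝒴) = g(φ𝒳,𝒴)` is positive definite. -/
structure GenRiemannian where
  φ : EndBig m M
  φ_sq : ∀ x (u : Big m M x), φ x (φ x u) = u
  φ_isometry : ∀ x (u v : Big m M x), g (φ x u) (φ x v) = g u v
  pos_def : ∀ x (u : Big m M x), u ≠ 0 → 0 < g (φ x u) u

/-- The metric `G(𝒳,𝒴) = g(φ𝒳,𝒴)`. -/
def GenRiemannian.G (𝒢 : GenRiemannian m M) {x : M} (u v : Big m M x) : ℝ := g (𝒢.φ x u) v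

variable (m M) in
/-- A generalized 2-nilpotent structure: a `g`-skew-symmetric endomorphism `τ` of `𝐓M` of constant
rank with `τ² = 0`. -/
structure TwoNilpotent where
  τ : EndBig m M
  τ_sq : ∀ x (u : Big m M x), τ x (τ x u) = 0
  τ_skew : ∀ x (u v : Big m M x), g u (τ x v) + g (τ x u) v = 0
  const_rank : ∃ r : ℕ, ∀ x, Module.finrank ℝ (LinearMap.range (τ x).toLinearMap) = r

namespace TwoNilpotent

variable (T : TwoNilpotent m M) (𝒢 : GenRiemannian m M)

/-- The fibre at `x` of the subbundle `E = im τ`. -/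
def E (x : M) : Submodule ℝ (Big m M x) := LinearMap.range (T.τ x).toLinearMap

/-- `ΓE`: the smooth sections of `𝐓M` with values in `E = im τ`. -/
def ΓE : Submodule ℝ (Sec m M) where
  carrier := {s | ∀ x, s x ∈ T.E x}
  add_mem' hs ht x := (T.E x).add_mem (hs x) (ht x)
  zero_mem' x := (T.E x).zero_mem
  smul_mem' c _ hs x := (T.E x).smul_mem c (hs x)

/-- The product `fe` of a smooth function `f` and a section `e` of `E`. -/
def fsmul (f : ContMDiffMap (𝓡 m) 𝓘(ℝ, ℝ) M ℝ ∞) (e : T.ΓE) : T.ΓE :=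
  ⟨⟨fun x => f x • e.1 x, f.contMDiff.smul_section e.1.contMDiff⟩,
    fun x => (T.E x).smul_mem (f x) (e.2 x)⟩

/-- `τ` is integrable: its Courant-Nijenhuis torsion vanishes. -/
def IsIntegrable : Prop := ∀ (𝒳 𝒴 : Sec m M) (x : M), courantNijenhuis T.τ 𝒳 𝒴 x = 0

/-- `(G,τ)` is a generalized metric 2-nilpotent structure: `τ : φ(E) → E` is a `G`-isometry. -/
def IsCompatible : Prop :=
  ∀ x, ∀ u ∈ (T.E x).map (𝒢.φ x).toLinearMap, ∀ v ∈ (T.E x).map (𝒢.φ x).toLinearMap,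
    𝒢.G (T.τ x u) (T.τ x v) = 𝒢.G u v

/-- The morphism `λ = τ ∘ φ` on the sections of `E`. -/
def lamΓ (e : T.ΓE) : T.ΓE :=
  ⟨app T.τ (app 𝒢.φ e.1), fun x => LinearMap.mem_range_self (T.τ x).toLinearMap (𝒢.φ x (e.1 x))⟩

/-- The `E`-Nijenhuis tensor `[λa,λb] - λ[a,λb] - λ[λa,b] + λ²[a,b]` of `λ = τ ∘ φ`, for sections
`a`, `b` of `E`. The bracket of `ΓE` is the Courant bracket; if `τ` is integrable, `ΓE` is closed
under it. -/
def nijenhuis (a b : T.ΓE) (x : M) : Big m M x :=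
  courant (T.lamΓ 𝒢 a).1 (T.lamΓ 𝒢 b).1 x - T.τ x (𝒢.φ x (courant a.1 (T.lamΓ 𝒢 b).1 x))
    - T.τ x (𝒢.φ x (courant (T.lamΓ 𝒢 a).1 b.1 x))
    + T.τ x (𝒢.φ x (T.τ x (𝒢.φ x (courant a.1 b.1 x))))

/-- `(G,τ)` is of Kähler type: the `E`-Nijenhuis tensor of `λ` vanishes. -/
def IsKahlerType : Prop := ∀ (a b : T.ΓE) (x : M), T.nijenhuis 𝒢 a b x = 0

/-- An `E`-connection on `E`; the anchor of `E` is the projection to `TM`. -/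
structure EConnection where
  D : T.ΓE → T.ΓE → T.ΓE
  add_left : ∀ a b e, D (a + b) e = D a e + D b e
  smul_left : ∀ f a e, D (T.fsmul f a) e = T.fsmul f (D a e)
  add_right : ∀ a e e', D a (e + e') = D a e + D a e'
  leibniz : ∀ f a e x,
    (D a (T.fsmul f e)).1 x = f x • (D a e).1 x + dirDeriv f (a.1 x).1 • e.1 x

/-- `D` is a Levi-Civita `E`-connection of `(E, G|_E)`: it is metric and torsion-free. -/
structure EConnection.IsLeviCivita {T : TwoNilpotent m M} (D : T.EConnection)
    (𝒢 : GenRiemannian m M) : Prop where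
  metric : ∀ (a b c : T.ΓE) (x : M),
    dirDeriv (fun y => 𝒢.G (b.1 y) (c.1 y)) (a.1 x).1 =
      𝒢.G ((D.D a b).1 x) (c.1 x) + 𝒢.G (b.1 x) ((D.D a c).1 x)
  torsion_free : ∀ (a b : T.ΓE) (x : M),
    (D.D a b).1 x - (D.D b a).1 x = courant a.1 b.1 x

/-- `(D_a λ)(b) = D_a(λb) - λ(D_a b)` for an `E`-connection `D`. -/
def covLam (D : T.EConnection) (a b : T.ΓE) : T.ΓE :=
  D.D a (T.lamΓ 𝒢 b) - T.lamΓ 𝒢 (D.D a b)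

end TwoNilpotent

end BigTangent

end

/-! Put `λ = τ ∘ φ`, a `G`-orthogonal complex structure on `E`, and `ω(a, b) = G(λa, b)`. The
subbundle `E` is `g`-isotropic, and every `a ∈ ΓE` equals `τ(-φλa)`. Evaluated on such sections,
integrability of `τ` says both that `ΓE` is closed under the Courant bracket and that `ω` is closed
for the resulting Lie algebroid structure. Since the Courant bracket preserves `g` up to the
differentials of the pairings, the Koszul formula on `E` can be written as
`2 D_a b = pr_E ([a, b] + φ[a, φb] + φ[b, φa])`, whose right-hand side is visibly a section. The
equivalence is then the one of almost Kähler geometry: the tensor `S(a, b, c) = G((D_a λ)b, c)` is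
skew in `b, c`, anticommutes with `λ`, and has vanishing cyclic sum because `dω = 0`; a vanishing
Nijenhuis tensor makes `S(λa, b, c) + S(a, λb, c)` symmetric in `a, b` and skew in `b, c`, hence
zero, and this forces `S = 0`. -/

noncomputable section

namespace BigTangent

section Trilinear

variable {α A : Type*} [AddCommGroup A] [IsAddTorsionFree A] {S : α → α → α → A}

theorem eq_zero_of_symm_of_skew (symm : ∀ a b c, S a b c = S b a c)
    (skew : ∀ a b c, S a b c = -S a c b) (a b c : α) : S a b c = 0 := by
  refine neg_eq_self.1 (Eq.symm ?_)
  calc S a b c = -S a c b := skew a b c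
    _ = -S c a b := by rw [symm]
    _ = S c b a := by rw [skew c a b, neg_neg]
    _ = S b c a := symm c b a
    _ = -S b a c := skew b c a
    _ = -S a b c := by rw [symm]

theorem eq_zero_of_kaehler_identities {J : α → α} (skew : ∀ a b c, S a b c = -S a c b)
    (hJ : ∀ a b c, S a (J b) c = S a b (J c)) (hJJ : ∀ a b c, S a b (J (J c)) = -S a b c)
    (cyclic : ∀ a b c, S a b c + S b c a + S c a b = 0)
    (nijenhuis : ∀ a b c, S (J a) b c - S (J b) a c + S a b (J c) - S b a (J c) = 0)
    (a b c : α) : S a b c = 0 := by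
  have antilinear : ∀ a b c, S (J a) b c + S a (J b) c = 0 :=
    eq_zero_of_symm_of_skew (S := fun a b c ↦ S (J a) b c + S a (J b) c)
      (fun a b c ↦ by
        linear_combination (norm := abel) nijenhuis a b c + hJ a b c - hJ b a c)
      (fun a b c ↦ by
        linear_combination (norm := abel) skew (J a) b c + hJ a b c + skew a b (J c))
  have vanish_J (a b c : α) : S c a (J b) = 0 := neg_eq_self.1 <| by
    linear_combination (norm := abel) antilinear a b c + antilinear b c a - hJ b c a + hJ c a b
      - cyclic (J a) b c - cyclic a (J b) c
  rw [← neg_eq_zero, ← hJJ, vanish_J]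

end Trilinear

section Smoothness

open Bundle VectorField

variable {𝕜 : Type*} [NontriviallyNormedField 𝕜] {n : WithTop ℕ∞}
  {E : Type*} [NormedAddCommGroup E] [NormedSpace 𝕜 E] {H : Type*} [TopologicalSpace H]
  {I : ModelWithCorners 𝕜 E H} {M : Type*} [TopologicalSpace M] [ChartedSpace H M]
  {F : Type*} [NormedAddCommGroup F] [NormedSpace 𝕜 F] {V : M → Type*} [∀ x, AddCommGroup (V x)]
  [∀ x, Module 𝕜 (V x)] [TopologicalSpace (TotalSpace F V)] [∀ x, TopologicalSpace (V x)]
  [FiberBundle F V] [VectorBundle 𝕜 F V]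
  {W : Type*} [NormedAddCommGroup W] [NormedSpace 𝕜 W]

/-- The product of a `C^n` function and a `C^n` section of a vector bundle. -/
instance instSMulSection : SMul C^n⟮I, M; 𝕜⟯ Cₛ^n⟮I; F, V⟯ where
  smul f s := ⟨fun x ↦ f x • s x, f.contMDiff.smul_section s.contMDiff⟩

theorem section_smul_apply (f : C^n⟮I, M; 𝕜⟯) (s : Cₛ^n⟮I; F, V⟯) (x : M) :
    (f • s) x = f x • s x := rfl

theorem contMDiffAt_hom_trivial_apply {η : ∀ x, V x →L[𝕜] Trivial M W x} {s : ∀ x, V x} {x₀ : M}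
    (hη : ContMDiffAt I (I.prod 𝓘(𝕜, F →L[𝕜] W)) n
      (fun x ↦ TotalSpace.mk' (F →L[𝕜] W) x (η x)) x₀)
    (hs : CMDiffAt n (T% s) x₀) : ContMDiffAt I 𝓘(𝕜, W) n (fun x ↦ (η x (s x) : W)) x₀ :=
  (contMDiffAt_section (E := Trivial M W) _).1 (hη.clm_bundle_apply hs)

theorem contMDiffAt_hom_trivial_of_apply [∀ x, IsTopologicalAddGroup (V x)]
    [∀ x, ContinuousSMul 𝕜 (V x)] [CompleteSpace 𝕜] [FiniteDimensional 𝕜 F]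
    [ContMDiffVectorBundle n F V I] {η : ∀ x, V x →L[𝕜] Trivial M W x} {x₀ : M}
    (h : ∀ s : ∀ x, V x, CMDiffAt n (T% s) x₀ →
      ContMDiffAt I 𝓘(𝕜, W) n (fun x ↦ (η x (s x) : W)) x₀) :
    ContMDiffAt I (I.prod 𝓘(𝕜, F →L[𝕜] W)) n
      (fun x ↦ TotalSpace.mk' (F →L[𝕜] W) x (η x)) x₀ := by
  let b := Module.finBasis 𝕜 F
  let e := trivializationAt F V x₀
  have local_frame (i) : CMDiffAt n (T% fun x ↦ e.symmL 𝕜 x (b i)) x₀ :=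
    (e.contMDiffAt_symmL (FiberBundle.mem_baseSet_trivializationAt' x₀)).clm_bundle_apply
      ((contMDiffAt_section (E := Trivial M F) x₀).2 contMDiffAt_const)
  have coordinates (x) : ContinuousLinearMap.inCoordinates F V W (Trivial M W) x₀ x x₀ x (η x) =
      ∑ i, ContinuousLinearMap.smulRightL 𝕜 F W (b.coord i).toContinuousLinearMap
        (η x (e.symmL 𝕜 x (b i))) := by
    have expand (v : F) : η x (e.symmL 𝕜 x v) = ∑ i, b.repr v i • η x (e.symmL 𝕜 x (b i)) := by
      conv_lhs => rw [← b.sum_repr v]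
      simp only [map_sum, map_smul]
    ext v
    simpa [ContinuousLinearMap.inCoordinates, e] using expand v
  rw [contMDiffAt_hom_bundle]
  simp only [coordinates]
  exact ⟨contMDiffAt_id, .sum fun i _ ↦
    (ContinuousLinearMap.contMDiff _).contMDiffAt.comp x₀ (h _ (local_frame i))⟩

theorem contMDiffAt_mvfderiv [IsManifold I 1 M] {f : M → W} {x₀ : M}
    (hf : CMDiffAt (n + 1) f x₀) :
    ContMDiffAt I (I.prod 𝓘(𝕜, E →L[𝕜] W)) n
      (fun x ↦ TotalSpace.mk' (E →L[𝕜] W) (E := fun x ↦ TangentSpace I x →L[𝕜] Trivial M W x) x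
        (mvfderiv I f x)) x₀ := by
  rw [contMDiffAt_hom_bundle]
  refine ⟨contMDiffAt_id, ?_⟩
  convert hf.mfderiv_const (m := n) le_rfl using 1
  ext x v
  simp only [inTangentCoordinates, ContinuousLinearMap.inCoordinates,
    Trivial.fiberBundle_trivializationAt', Trivial.continuousLinearMapAt_trivialization,
    ContinuousLinearMap.id_comp, TangentBundle.continuousLinearMapAt_model_space]
  rfl

theorem contMDiffAt_mlieBracket [IsRCLikeNormedField 𝕜] [CompleteSpace E] [IsManifold I ∞ M]
    {X Y : ∀ x : M, TangentSpace I x} {x₀ : M} (hX : CMDiffAt ∞ (T% X) x₀)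
    (hY : CMDiffAt ∞ (T% Y) x₀) : CMDiffAt ∞ (T% (mlieBracket I X Y)) x₀ := by
  have : IsManifold I (minSmoothness 𝕜 2) M := by
    rw [minSmoothness_of_isRCLikeNormedField]
    infer_instance
  have : IsManifold I (((⊤ : ℕ∞) : WithTop ℕ∞) + 1) M := ‹IsManifold I ∞ M›
  exact hX.mlieBracket_vectorField (m := ⊤) (n := ⊤) hY (by simp)

end Smoothness

variable {m : ℕ} {M : Type*} [TopologicalSpace M] [ChartedSpace (EuclideanSpace ℝ (Fin m)) M]

section Differential

/-- The differential `df` of a function, as a field of elements of `T*M`. -/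
def differential (f : M → ℝ) (x : M) : Cotangent m M x := mvfderiv (𝓡 m) f x

/-- The differential `df` of a function, as a field of elements `(0, df)` of `𝐓M`. -/
def dBig (f : M → ℝ) (x : M) : Big m M x := (0, differential f x)

variable {f h : M → ℝ} {x : M}

theorem differential_neg : (differential (fun y ↦ -f y) x : Cotangent m M x) = -differential f x :=
  mvfderiv_fun_neg

theorem differential_add (hf : MDifferentiableAt (𝓡 m) 𝓘(ℝ, ℝ) f x)
    (hh : MDifferentiableAt (𝓡 m) 𝓘(ℝ, ℝ) h x) :
    (differential (fun y ↦ f y + h y) x : Cotangent m M x) = differential f x + differential h x :=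
  mvfderiv_fun_add hf hh

theorem differential_mul (hf : MDifferentiableAt (𝓡 m) 𝓘(ℝ, ℝ) f x)
    (hh : MDifferentiableAt (𝓡 m) 𝓘(ℝ, ℝ) h x) :
    (differential (fun y ↦ f y * h y) x : Cotangent m M x) =
      f x • differential h x + h x • differential f x :=
  mvfderiv_fun_mul hf hh

variable (v w : TangentSpace (𝓡 m) x)

theorem dirDeriv_add_vec : dirDeriv f (v + w) = dirDeriv f v + dirDeriv f w := map_add _ _ _

theorem dirDeriv_smul_vec (c : ℝ) : dirDeriv f (c • v) = c * dirDeriv f v := map_smul _ _ _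

theorem dirDeriv_const (c : ℝ) : dirDeriv (fun _ ↦ c) v = 0 :=
  DFunLike.congr_fun (mvfderiv_const c) v

theorem dirDeriv_neg : dirDeriv (fun y ↦ -f y) v = -dirDeriv f v :=
  DFunLike.congr_fun differential_neg v

theorem dirDeriv_add (hf : MDifferentiableAt (𝓡 m) 𝓘(ℝ, ℝ) f x)
    (hh : MDifferentiableAt (𝓡 m) 𝓘(ℝ, ℝ) h x) :
    dirDeriv (fun y ↦ f y + h y) v = dirDeriv f v + dirDeriv h v :=
  DFunLike.congr_fun (differential_add hf hh) v

theorem dirDeriv_sub (hf : MDifferentiableAt (𝓡 m) 𝓘(ℝ, ℝ) f x)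
    (hh : MDifferentiableAt (𝓡 m) 𝓘(ℝ, ℝ) h x) :
    dirDeriv (fun y ↦ f y - h y) v = dirDeriv f v - dirDeriv h v :=
  DFunLike.congr_fun (mvfderiv_fun_sub hf hh) v

theorem dirDeriv_mul (hf : MDifferentiableAt (𝓡 m) 𝓘(ℝ, ℝ) f x)
    (hh : MDifferentiableAt (𝓡 m) 𝓘(ℝ, ℝ) h x) :
    dirDeriv (fun y ↦ f y * h y) v = f x * dirDeriv h v + h x * dirDeriv f v :=
  DFunLike.congr_fun (differential_mul hf hh) v

theorem mdifferentiableAt_contMDiffMap (f : C^∞⟮𝓡 m, M; ℝ⟯) :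
    MDifferentiableAt (𝓡 m) 𝓘(ℝ, ℝ) f x :=
  f.contMDiff.mdifferentiable (by simp) x

theorem contMDiffAt_differential [IsManifold (𝓡 m) ∞ M] (hf : ContMDiffAt (𝓡 m) 𝓘(ℝ, ℝ) ∞ f x) :
    ContMDiffAt (𝓡 m) ((𝓡 m).prod 𝓘(ℝ, CoModel m)) ∞
      (fun y ↦ Bundle.TotalSpace.mk' (CoModel m) (E := Cotangent m M) y (differential f y)) x :=
  contMDiffAt_mvfderiv (n := ∞) hf

end Differential

section LieDerivative

open VectorField

variable [IsManifold (𝓡 m) ∞ M] {x : M} (X Y : VField m M) (μ ν : OneForm m M)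
  (f : C^∞⟮𝓡 m, M; ℝ⟯) {Z : ∀ y : M, TangentSpace (𝓡 m) y}

theorem cotangent_ext {α β : Cotangent m M x}
    (h : ∀ Z : ∀ y : M, TangentSpace (𝓡 m) y, MDifferentiableAt (𝓡 m) (𝓡 m).tangent (T% Z) x →
      α (Z x) = β (Z x)) : α = β := by
  ext w
  simpa using h _ (FiberBundle.mdifferentiableAt_extend (𝓡 m) (Model m) w)

theorem mdifferentiableAt_vField :
    MDifferentiableAt (𝓡 m) (𝓡 m).tangent (T% fun y ↦ X y) x :=
  X.contMDiff.mdifferentiable (by simp) x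

theorem lieDeriv_apply (hZ : MDifferentiableAt (𝓡 m) (𝓡 m).tangent (T% Z) x) :
    lieDeriv X μ x (Z x) =
      dirDeriv (fun y ↦ μ y (Z y)) (X x) - μ x (mlieBracket (𝓡 m) X Z x) :=
  TensorialAt.mkHom_apply (lieDerivAux_tensorial X μ x) hZ

theorem lieDeriv_add_right : lieDeriv X (μ + ν) x = lieDeriv X μ x + lieDeriv X ν x :=
  cotangent_ext fun Z hZ ↦ by
    have h := dirDeriv_add (X x) (mdifferentiableAt_pair μ hZ) (mdifferentiableAt_pair ν hZ)
    calc lieDeriv X (μ + ν) x (Z x)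
        = dirDeriv (fun y ↦ μ y (Z y) + ν y (Z y)) (X x)
          - (μ x (mlieBracket (𝓡 m) X Z x) + ν x (mlieBracket (𝓡 m) X Z x)) :=
        lieDeriv_apply X (μ + ν) hZ
      _ = lieDeriv X μ x (Z x) + lieDeriv X ν x (Z x) := by
        rw [lieDeriv_apply X μ hZ, lieDeriv_apply X ν hZ]
        linear_combination h

theorem lieDeriv_add_left : lieDeriv (X + Y) μ x = lieDeriv X μ x + lieDeriv Y μ x :=
  cotangent_ext fun Z hZ ↦ by
    have bracket_add : mlieBracket (𝓡 m) (⇑X + ⇑Y) Z x =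
        mlieBracket (𝓡 m) X Z x + mlieBracket (𝓡 m) Y Z x :=
      mlieBracket_add_left (mdifferentiableAt_vField X) (mdifferentiableAt_vField Y)
    simp only [lieDeriv_apply _ _ hZ, add_apply, ContMDiffSection.coe_add, Pi.add_apply,
      bracket_add, dirDeriv_add_vec, map_add]
    ring

theorem lieDeriv_smul_right :
    lieDeriv X (f • μ) x = f x • lieDeriv X μ x + dirDeriv f (X x) • μ x :=
  cotangent_ext fun Z hZ ↦ by
    have h := dirDeriv_mul (X x) (mdifferentiableAt_contMDiffMap f) (mdifferentiableAt_pair μ hZ)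
    calc lieDeriv X (f • μ) x (Z x)
        = dirDeriv (fun y ↦ f y * μ y (Z y)) (X x) - f x * μ x (mlieBracket (𝓡 m) X Z x) :=
        lieDeriv_apply X (f • μ) hZ
      _ = f x * lieDeriv X μ x (Z x) + dirDeriv f (X x) * μ x (Z x) := by
        rw [lieDeriv_apply X μ hZ]
        linear_combination h

theorem lieDeriv_smul_left :
    lieDeriv (f • X) μ x = f x • lieDeriv X μ x + μ x (X x) • differential f x :=
  cotangent_ext fun Z hZ ↦ by
    have leibniz : mlieBracket (𝓡 m) (⇑f • ⇑X) Z x =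
        -dirDeriv f (Z x) • X x + f x • mlieBracket (𝓡 m) X Z x :=
      mlieBracket_smul_left (mdifferentiableAt_contMDiffMap f) (mdifferentiableAt_vField X)
    calc lieDeriv (f • X) μ x (Z x)
        = dirDeriv (fun y ↦ μ y (Z y)) (f x • X x) - μ x (mlieBracket (𝓡 m) (⇑f • ⇑X) Z x) :=
        lieDeriv_apply (f • X) μ hZ
      _ = f x * lieDeriv X μ x (Z x) + μ x (X x) * dirDeriv f (Z x) := by
        rw [lieDeriv_apply X μ hZ, leibniz, dirDeriv_smul_vec, map_add, map_smul, map_smul,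
          smul_eq_mul, smul_eq_mul]
        ring

theorem contMDiffAt_lieDeriv (x₀ : M) :
    ContMDiffAt (𝓡 m) ((𝓡 m).prod 𝓘(ℝ, CoModel m)) ∞
      (fun x ↦ Bundle.TotalSpace.mk' (CoModel m) x (lieDeriv X μ x)) x₀ := by
  refine contMDiffAt_hom_trivial_of_apply fun Z hZ ↦ ?_
  have smooth_deriv := contMDiffAt_hom_trivial_apply
    (contMDiffAt_differential (contMDiffAt_hom_trivial_apply (μ.contMDiff x₀) hZ)) (X.contMDiff x₀)
  have smooth_bracket := contMDiffAt_hom_trivial_apply (μ.contMDiff x₀)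
    (contMDiffAt_mlieBracket (X.contMDiff x₀) hZ)
  refine (smooth_deriv.sub smooth_bracket).congr_of_eventuallyEq ?_
  have : IsManifold (𝓡 m) 1 M := IsManifold.of_le (n := ∞) (by simp)
  filter_upwards [(contMDiffAt_iff_contMDiffAt_nhds (n := 1) (by simp)).1
    (ContMDiffAt.of_le hZ (by simp))] with x hx
  exact lieDeriv_apply X μ (hx.mdifferentiableAt (by simp))

end LieDerivative

section NeutralMetric

variable {x : M} (u v w : Big m M x) (c : ℝ)

theorem g_comm : g u v = g v u := add_comm _ _

theorem g_zero_left : g 0 v = 0 := by simp [g]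

theorem g_add_left : g (u + v) w = g u w + g v w := by
  simp only [g, Prod.fst_add, Prod.snd_add, add_apply, map_add]
  ring

theorem g_smul_left : g (c • u) v = c * g u v := by
  simp only [g, Prod.smul_fst, Prod.smul_snd, smul_apply, map_smul, smul_eq_mul]
  ring

theorem g_neg_left : g (-u) v = -g u v := by
  rw [← neg_one_smul ℝ u, g_smul_left, neg_one_mul]

theorem g_sub_left : g (u - v) w = g u w - g v w := by
  rw [sub_eq_add_neg, g_add_left, g_neg_left, ← sub_eq_add_neg]

/-- The skew-symmetric pairing `α(Y) - μ(X)` of `(X, α)` and `(Y, μ)`, whose differential enters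
the Courant bracket. -/
def skewPairing : ℝ := u.2 v.1 - v.2 u.1

end NeutralMetric

variable [IsManifold (𝓡 m) ∞ M]

section Courant

open VectorField

variable (𝒳 𝒴 𝒵 : Sec m M) (x : M)

theorem vec_apply : vec 𝒳 x = (𝒳 x).1 := rfl

theorem form_apply : form 𝒳 x = (𝒳 x).2 := rfl

theorem contMDiff_pairing : ContMDiff (𝓡 m) 𝓘(ℝ, ℝ) ∞ (fun y ↦ ((𝒳 y).2 (𝒴 y).1 : ℝ)) :=
  fun x ↦ contMDiffAt_hom_trivial_apply ((form 𝒳).contMDiff x) ((vec 𝒴).contMDiff x)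

theorem mdifferentiableAt_pairing :
    MDifferentiableAt (𝓡 m) 𝓘(ℝ, ℝ) (fun y ↦ ((𝒳 y).2 (𝒴 y).1 : ℝ)) x :=
  (contMDiff_pairing 𝒳 𝒴).mdifferentiable (by simp) x

theorem contMDiff_skewPairing :
    ContMDiff (𝓡 m) 𝓘(ℝ, ℝ) ∞ (fun y ↦ skewPairing (𝒳 y) (𝒴 y)) :=
  (contMDiff_pairing 𝒳 𝒴).sub (contMDiff_pairing 𝒴 𝒳)

theorem mdifferentiableAt_skewPairing :
    MDifferentiableAt (𝓡 m) 𝓘(ℝ, ℝ) (fun y ↦ skewPairing (𝒳 y) (𝒴 y)) x :=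
  (contMDiff_skewPairing 𝒳 𝒴).mdifferentiable (by simp) x

theorem courant_snd : (courant 𝒳 𝒴 x).2 =
    lieDeriv (vec 𝒳) (form 𝒴) x - lieDeriv (vec 𝒴) (form 𝒳) x +
      (1 / 2 : ℝ) • differential (fun y ↦ skewPairing (𝒳 y) (𝒴 y)) x := rfl

theorem courant_swap : courant 𝒴 𝒳 x = -courant 𝒳 𝒴 x := by
  refine Prod.ext mlieBracket_swap_apply ?_
  have h : (fun y ↦ skewPairing (𝒴 y) (𝒳 y)) = fun y ↦ -skewPairing (𝒳 y) (𝒴 y) :=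
    funext fun y ↦ (neg_sub _ _).symm
  rw [Prod.snd_neg, courant_snd, courant_snd, h, differential_neg]
  module

theorem courant_add_right : courant 𝒳 (𝒴 + 𝒵) x = courant 𝒳 𝒴 x + courant 𝒳 𝒵 x := by
  refine Prod.ext (mlieBracket_add_right (mdifferentiableAt_vField (vec 𝒴))
    (mdifferentiableAt_vField (vec 𝒵))) ?_
  have h : (fun y ↦ skewPairing (𝒳 y) ((𝒴 + 𝒵) y)) =
      fun y ↦ skewPairing (𝒳 y) (𝒴 y) + skewPairing (𝒳 y) (𝒵 y) := by
    ext y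
    simp only [skewPairing, ContMDiffSection.coe_add, Pi.add_apply, Prod.fst_add, Prod.snd_add,
      map_add, add_apply]
    ring
  have hvec : vec (𝒴 + 𝒵) = vec 𝒴 + vec 𝒵 := rfl
  have hform : form (𝒴 + 𝒵) = form 𝒴 + form 𝒵 := rfl
  rw [Prod.snd_add, courant_snd, courant_snd, courant_snd, h, hvec, hform, lieDeriv_add_left,
    lieDeriv_add_right, differential_add (mdifferentiableAt_skewPairing 𝒳 𝒴 x)
      (mdifferentiableAt_skewPairing 𝒳 𝒵 x)]
  module

theorem courant_add_left : courant (𝒳 + 𝒴) 𝒵 x = courant 𝒳 𝒵 x + courant 𝒴 𝒵 x := by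
  rw [courant_swap, courant_add_right, courant_swap 𝒳, courant_swap 𝒴]
  abel

variable (f : C^∞⟮𝓡 m, M; ℝ⟯)

theorem courant_smul_right : courant 𝒳 (f • 𝒴) x =
    f x • courant 𝒳 𝒴 x + dirDeriv f (𝒳 x).1 • 𝒴 x - (1 / 2 * g (𝒳 x) (𝒴 x)) • dBig f x := by
  have leibniz : (courant 𝒳 (f • 𝒴) x).1 =
      dirDeriv f (𝒳 x).1 • (𝒴 x).1 + f x • (courant 𝒳 𝒴 x).1 :=
    mlieBracket_smul_right (mdifferentiableAt_contMDiffMap f) (mdifferentiableAt_vField (vec 𝒴))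
  have h : (fun y ↦ skewPairing (𝒳 y) ((f • 𝒴) y)) =
      fun y ↦ f y * skewPairing (𝒳 y) (𝒴 y) := by
    ext y
    simp only [skewPairing, section_smul_apply, Prod.smul_fst, Prod.smul_snd, map_smul, smul_apply,
      smul_eq_mul]
    ring
  have hvec : vec (f • 𝒴) = f • vec 𝒴 := rfl
  have hform : form (f • 𝒴) = f • form 𝒴 := rfl
  refine Prod.ext ?_ ?_
  · rw [leibniz]
    simp only [dBig, Prod.fst_add, Prod.fst_sub, Prod.smul_fst]
    module
  · simp only [dBig, Prod.snd_add, Prod.snd_sub, Prod.smul_snd]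
    rw [courant_snd, courant_snd, h, hvec, hform, lieDeriv_smul_left,
      lieDeriv_smul_right, differential_mul (mdifferentiableAt_contMDiffMap f)
        (mdifferentiableAt_skewPairing 𝒳 𝒴 x)]
    simp only [g, skewPairing, vec_apply, form_apply]
    module

theorem courant_smul_left : courant (f • 𝒳) 𝒴 x =
    f x • courant 𝒳 𝒴 x - dirDeriv f (𝒴 x).1 • 𝒳 x + (1 / 2 * g (𝒳 x) (𝒴 x)) • dBig f x := by
  rw [courant_swap, courant_smul_right, courant_swap 𝒳, g_comm]
  module

theorem courant_snd_apply : ((courant 𝒳 𝒴 x).2 (𝒵 x).1 : ℝ) =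
    dirDeriv (fun y ↦ (𝒴 y).2 (𝒵 y).1) (𝒳 x).1 - (𝒴 x).2 (courant 𝒳 𝒵 x).1
      - (dirDeriv (fun y ↦ (𝒳 y).2 (𝒵 y).1) (𝒴 x).1 - (𝒳 x).2 (courant 𝒴 𝒵 x).1)
      + 1 / 2 * dirDeriv (fun y ↦ skewPairing (𝒳 y) (𝒴 y)) (𝒵 x).1 :=
  congrArg₂ (· + ·)
    (congrArg₂ (· - ·) (lieDeriv_apply (vec 𝒳) (form 𝒴) (mdifferentiableAt_vField (vec 𝒵)))
      (lieDeriv_apply (vec 𝒴) (form 𝒳) (mdifferentiableAt_vField (vec 𝒵)))) rfl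

theorem dirDeriv_g :
    dirDeriv (fun y ↦ g (𝒴 y) (𝒵 y)) (𝒳 x).1 =
      g (courant 𝒳 𝒴 x) (𝒵 x) + g (𝒴 x) (courant 𝒳 𝒵 x)
      + 1 / 2 * dirDeriv (fun y ↦ g (𝒳 y) (𝒴 y)) (𝒵 x).1
      + 1 / 2 * dirDeriv (fun y ↦ g (𝒳 y) (𝒵 y)) (𝒴 x).1 := by
  have g_split (𝒜 ℬ : Sec m M) (v : TangentSpace (𝓡 m) x) :
      dirDeriv (fun y ↦ g (𝒜 y) (ℬ y)) v =
        dirDeriv (fun y ↦ (𝒜 y).2 (ℬ y).1) v + dirDeriv (fun y ↦ (ℬ y).2 (𝒜 y).1) v :=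
    dirDeriv_add v (mdifferentiableAt_pairing 𝒜 ℬ x) (mdifferentiableAt_pairing ℬ 𝒜 x)
  have skewPairing_split (𝒜 ℬ : Sec m M) (v : TangentSpace (𝓡 m) x) :
      dirDeriv (fun y ↦ skewPairing (𝒜 y) (ℬ y)) v =
        dirDeriv (fun y ↦ (𝒜 y).2 (ℬ y).1) v - dirDeriv (fun y ↦ (ℬ y).2 (𝒜 y).1) v :=
    dirDeriv_sub v (mdifferentiableAt_pairing 𝒜 ℬ x) (mdifferentiableAt_pairing ℬ 𝒜 x)
  have swap : (𝒳 x).2 (courant 𝒵 𝒴 x).1 = -(𝒳 x).2 (courant 𝒴 𝒵 x).1 := by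
    rw [courant_swap 𝒴 𝒵, Prod.fst_neg, map_neg]
  have h𝒵 := courant_snd_apply 𝒳 𝒴 𝒵 x
  have h𝒴 := courant_snd_apply 𝒳 𝒵 𝒴 x
  rw [skewPairing_split] at h𝒵 h𝒴
  rw [g_split, g_split, g_split, g, g]
  linear_combination -h𝒵 - h𝒴 - swap

variable {x} in
theorem contMDiffAt_big {u : ∀ y : M, Big m M y}
    (h₁ : ContMDiffAt (𝓡 m) (𝓡 m).tangent ∞ (T% fun y ↦ (u y).1) x)
    (h₂ : ContMDiffAt (𝓡 m) ((𝓡 m).prod 𝓘(ℝ, CoModel m)) ∞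
      (fun y ↦ Bundle.TotalSpace.mk' (CoModel m) y (u y).2) x) :
    ContMDiffAt (𝓡 m) ((𝓡 m).prod 𝓘(ℝ, BigModel m)) ∞
      (fun y ↦ Bundle.TotalSpace.mk' (BigModel m) y (u y)) x := by
  rw [Bundle.contMDiffAt_section] at *
  exact h₁.prodMk_space h₂

theorem contMDiff_courant : ContMDiff (𝓡 m) ((𝓡 m).prod 𝓘(ℝ, BigModel m)) ∞
    (fun x ↦ Bundle.TotalSpace.mk' (BigModel m) x (courant 𝒳 𝒴 x)) := fun x ↦
  contMDiffAt_big (contMDiffAt_mlieBracket ((vec 𝒳).contMDiff x) ((vec 𝒴).contMDiff x))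
    (((contMDiffAt_lieDeriv (vec 𝒳) (form 𝒴) x).sub_section
      (contMDiffAt_lieDeriv (vec 𝒴) (form 𝒳) x)).add_section
      ((contMDiffAt_differential (contMDiff_skewPairing 𝒳 𝒴 x)).const_smul_section))

/-- The Courant bracket as an operation on `Γ(𝐓M)`. -/
def bracket : Sec m M := ⟨courant 𝒳 𝒴, contMDiff_courant 𝒳 𝒴⟩

end Courant

section Endomorphism

variable (Ψ : EndBig m M) (f : C^∞⟮𝓡 m, M; ℝ⟯) (𝒳 𝒴 : Sec m M)

theorem app_apply (x : M) : app Ψ 𝒳 x = Ψ x (𝒳 x) := rfl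

theorem app_add : app Ψ (𝒳 + 𝒴) = app Ψ 𝒳 + app Ψ 𝒴 :=
  ContMDiffSection.ext fun x ↦ map_add (Ψ x) _ _

theorem app_smul : app Ψ (f • 𝒳) = f • app Ψ 𝒳 :=
  ContMDiffSection.ext fun x ↦ map_smul (Ψ x) _ _

end Endomorphism

namespace GenRiemannian

variable (𝒢 : GenRiemannian m M) {x : M} (u v w : Big m M x) (c : ℝ)

theorem g_φ_left : g (𝒢.φ x u) v = g u (𝒢.φ x v) := by
  rw [← 𝒢.φ_isometry x u, 𝒢.φ_sq]

theorem G_comm : 𝒢.G u v = 𝒢.G v u := by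
  rw [G, G, 𝒢.g_φ_left, g_comm]

theorem G_zero_left : 𝒢.G 0 v = 0 := by
  rw [G, map_zero, g_zero_left]

theorem G_add_left : 𝒢.G (u + v) w = 𝒢.G u w + 𝒢.G v w := by
  rw [G, map_add, g_add_left, G, G]

theorem G_smul_left : 𝒢.G (c • u) v = c * 𝒢.G u v := by
  rw [G, map_smul, g_smul_left, G]

theorem G_neg_left : 𝒢.G (-u) v = -𝒢.G u v := by
  rw [G, map_neg, g_neg_left, G]

theorem G_sub_left : 𝒢.G (u - v) w = 𝒢.G u w - 𝒢.G v w := by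
  rw [G, map_sub, g_sub_left, G, G]

theorem G_courant_swap (𝒳 𝒴 : Sec m M) :
    𝒢.G (courant 𝒴 𝒳 x) u = -𝒢.G (courant 𝒳 𝒴 x) u := by
  rw [courant_swap, G_neg_left]

variable {𝒢 u} in
theorem eq_zero_of_G_self (h : 𝒢.G u u = 0) : u = 0 :=
  not_ne_iff.1 fun hu ↦ (𝒢.pos_def x u hu).ne' h

section Koszul

variable (𝒳 𝒴 𝒵 : Sec m M) (f : C^∞⟮𝓡 m, M; ℝ⟯) (x : M)

/-- The section `[𝒳, 𝒴] + φ[𝒳, φ𝒴] + φ[𝒴, φ𝒳]`. For sections of `E` its `G`-orthogonal projection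
to `E` is twice the Levi-Civita derivative, because the invariance of `g` under the Courant bracket
turns its `G`-products into the Koszul formula. -/
def koszul : Sec m M :=
  bracket 𝒳 𝒴 + app 𝒢.φ (bracket 𝒳 (app 𝒢.φ 𝒴)) + app 𝒢.φ (bracket 𝒴 (app 𝒢.φ 𝒳))

theorem koszul_apply : 𝒢.koszul 𝒳 𝒴 x =
    courant 𝒳 𝒴 x + 𝒢.φ x (courant 𝒳 (app 𝒢.φ 𝒴) x) + 𝒢.φ x (courant 𝒴 (app 𝒢.φ 𝒳) x) := rfl

theorem koszul_add_left : 𝒢.koszul (𝒳 + 𝒴) 𝒵 = 𝒢.koszul 𝒳 𝒵 + 𝒢.koszul 𝒴 𝒵 := by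
  ext1 x
  simp only [koszul_apply, ContMDiffSection.coe_add, Pi.add_apply, app_add, courant_add_left,
    courant_add_right, map_add]
  abel

theorem koszul_add_right : 𝒢.koszul 𝒳 (𝒴 + 𝒵) = 𝒢.koszul 𝒳 𝒴 + 𝒢.koszul 𝒳 𝒵 := by
  ext1 x
  simp only [koszul_apply, ContMDiffSection.coe_add, Pi.add_apply, app_add, courant_add_left,
    courant_add_right, map_add]
  abel

theorem koszul_smul_left : 𝒢.koszul (f • 𝒳) 𝒴 x = f x • 𝒢.koszul 𝒳 𝒴 x
    - dirDeriv f (𝒢.φ x (𝒴 x)).1 • 𝒢.φ x (𝒳 x) + (1 / 2 * g (𝒳 x) (𝒴 x)) • dBig f x := by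
  have symm : g (𝒴 x) (𝒢.φ x (𝒳 x)) = g (𝒳 x) (𝒢.φ x (𝒴 x)) := by rw [← 𝒢.g_φ_left, g_comm]
  simp only [koszul_apply, app_smul, courant_smul_left, courant_smul_right, map_add, map_sub,
    map_smul, app_apply, 𝒢.φ_sq, symm]
  module

theorem koszul_smul_right : 𝒢.koszul 𝒳 (f • 𝒴) x = f x • 𝒢.koszul 𝒳 𝒴 x
    + (2 * dirDeriv f (𝒳 x).1) • 𝒴 x - dirDeriv f (𝒢.φ x (𝒳 x)).1 • 𝒢.φ x (𝒴 x)
    - (1 / 2 * g (𝒳 x) (𝒴 x)) • dBig f x := by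
  have symm : g (𝒴 x) (𝒢.φ x (𝒳 x)) = g (𝒳 x) (𝒢.φ x (𝒴 x)) := by rw [← 𝒢.g_φ_left, g_comm]
  simp only [koszul_apply, app_smul, courant_smul_left, courant_smul_right, map_add, map_sub,
    map_smul, app_apply, 𝒢.φ_sq, symm]
  module

end Koszul

end GenRiemannian

namespace TwoNilpotent

section Fibre

variable (T : TwoNilpotent m M) (𝒢 : GenRiemannian m M) {x : M} (u v w : Big m M x)

theorem g_τ_right : g u (T.τ x v) = -g (T.τ x u) v :=
  eq_neg_of_add_eq_zero_left (T.τ_skew x u v)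

theorem τ_mem : T.τ x u ∈ T.E x := ⟨u, rfl⟩

variable {u} in
theorem τ_eq_zero (hu : u ∈ T.E x) : T.τ x u = 0 := by
  obtain ⟨u, rfl⟩ := hu
  exact T.τ_sq x u

variable {u v} in
theorem g_eq_zero (hu : u ∈ T.E x) (hv : v ∈ T.E x) : g u v = 0 := by
  obtain ⟨v, rfl⟩ := hv
  calc g u (T.τ x v) = -g (T.τ x u) v := T.g_τ_right u v
    _ = 0 := by rw [T.τ_eq_zero hu, g_zero_left, neg_zero]

variable (x) in
/-- The endomorphism `λ = τ ∘ φ` of the fibre of `𝐓M` at `x`, extending the complex structure `λ`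
of `E`. -/
def lam : Big m M x →L[ℝ] Big m M x := (T.τ x).comp (𝒢.φ x)

theorem lam_mem : T.lam 𝒢 x u ∈ T.E x := T.τ_mem _

variable {u} in
theorem lam_φ_eq_zero (hu : u ∈ T.E x) : T.lam 𝒢 x (𝒢.φ x u) = 0 := by
  rw [lam, ContinuousLinearMap.comp_apply, 𝒢.φ_sq, T.τ_eq_zero hu]

theorem G_lam_left : 𝒢.G (T.lam 𝒢 x u) v = -𝒢.G u (T.lam 𝒢 x v) := by
  calc g (𝒢.φ x (T.τ x (𝒢.φ x u))) v = g (T.τ x (𝒢.φ x u)) (𝒢.φ x v) := 𝒢.g_φ_left _ _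
    _ = -g (𝒢.φ x u) (T.τ x (𝒢.φ x v)) := by rw [T.g_τ_right, neg_neg]

variable {T 𝒢 u v}

theorem IsCompatible.G_lam_lam (hG : T.IsCompatible 𝒢) (hu : u ∈ T.E x) (hv : v ∈ T.E x) :
    𝒢.G (T.lam 𝒢 x u) (T.lam 𝒢 x v) = 𝒢.G u v :=
  (hG x (𝒢.φ x u) ⟨u, hu, rfl⟩ (𝒢.φ x v) ⟨v, hv, rfl⟩).trans (𝒢.φ_isometry x _ _)

theorem IsCompatible.lam_lam (hG : T.IsCompatible 𝒢) (hu : u ∈ T.E x) :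
    T.lam 𝒢 x (T.lam 𝒢 x u) = -u := by
  have orthogonal (v) (hv : v ∈ T.E x) : 𝒢.G (T.lam 𝒢 x (T.lam 𝒢 x u) + u) v = 0 := by
    rw [𝒢.G_add_left, G_lam_left, hG.G_lam_lam hu hv, neg_add_cancel]
  exact eq_neg_of_add_eq_zero_left <|
    𝒢.eq_zero_of_G_self (orthogonal _ ((T.E x).add_mem (T.lam_mem 𝒢 _) hu))

theorem IsCompatible.G_neg_lam_lam (hG : T.IsCompatible 𝒢) (hv : v ∈ T.E x) :
    𝒢.G (-T.lam 𝒢 x (T.lam 𝒢 x u)) v = 𝒢.G u v := by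
  rw [𝒢.G_neg_left, G_lam_left, G_lam_left, neg_neg, hG.lam_lam hv, 𝒢.G_comm, 𝒢.G_neg_left,
    neg_neg, 𝒢.G_comm]

end Fibre

variable (T : TwoNilpotent m M) (𝒢 : GenRiemannian m M)

section Sections

variable {T} in
theorem ΓE_ext {a b : T.ΓE} (h : ∀ x, a.1 x = b.1 x) : a = b :=
  Subtype.ext (ContMDiffSection.ext h)

variable (a b : T.ΓE) (f : C^∞⟮𝓡 m, M; ℝ⟯) (x : M)

theorem neg_apply : (-a).1 x = -a.1 x := rfl

theorem fsmul_apply : (T.fsmul f a).1 x = f x • a.1 x := rfl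

theorem fsmul_coe : (T.fsmul f a).1 = f • a.1 := rfl

theorem lamΓ_apply : (T.lamΓ 𝒢 a).1 x = T.lam 𝒢 x (a.1 x) := rfl

variable {T 𝒢}

theorem g_section_eq_zero : (fun y ↦ g (a.1 y) (b.1 y)) = fun _ ↦ 0 :=
  funext fun y ↦ T.g_eq_zero (a.2 y) (b.2 y)

variable {a b} in
theorem eq_of_G_eq (h : ∀ (c : T.ΓE) x, 𝒢.G (a.1 x - b.1 x) (c.1 x) = 0) : a = b :=
  ΓE_ext fun x ↦ sub_eq_zero.1 (𝒢.eq_zero_of_G_self (h (a - b) x))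

theorem IsCompatible.lamΓ_lamΓ (hG : T.IsCompatible 𝒢) : T.lamΓ 𝒢 (T.lamΓ 𝒢 a) = -a :=
  ΓE_ext fun x ↦ hG.lam_lam (a.2 x)

end Sections

section Integrability

/-- The section `-φλa`, which `τ` maps to `a` when `τ` is compatible with `G`. -/
def lift (a : T.ΓE) : Sec m M := -app 𝒢.φ (T.lamΓ 𝒢 a).1

variable {T 𝒢} (a b c : T.ΓE) (x : M)

theorem IsCompatible.τ_lift (hG : T.IsCompatible 𝒢) : T.τ x (T.lift 𝒢 a x) = a.1 x := by
  calc T.τ x (-𝒢.φ x (T.lam 𝒢 x (a.1 x))) = -T.lam 𝒢 x (T.lam 𝒢 x (a.1 x)) := map_neg _ _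
    _ = a.1 x := by rw [hG.lam_lam (a.2 x), neg_neg]

theorem IsIntegrable.courant_eq (hI : T.IsIntegrable) (hG : T.IsCompatible 𝒢) :
    courant a.1 b.1 x =
      T.τ x (courant (T.lift 𝒢 a) b.1 x) + T.τ x (courant a.1 (T.lift 𝒢 b) x) := by
  have app_τ_lift (e : T.ΓE) : app T.τ (T.lift 𝒢 e) = e.1 :=
    ContMDiffSection.ext fun y ↦ hG.τ_lift e y
  have torsion := hI (T.lift 𝒢 a) (T.lift 𝒢 b) x
  rwa [courantNijenhuis, app_τ_lift, app_τ_lift, T.τ_sq, add_zero, sub_sub, sub_eq_zero] at torsion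

theorem IsIntegrable.courant_mem (hI : T.IsIntegrable) (hG : T.IsCompatible 𝒢) :
    courant a.1 b.1 x ∈ T.E x := by
  rw [hI.courant_eq a b x hG]
  exact (T.E x).add_mem (T.τ_mem _) (T.τ_mem _)

end Integrability

section LeviCivita

/-- The operator `-λ²` from `Γ(𝐓M)` to `ΓE`, the `G`-orthogonal projection when `τ` is compatible
with `G`. -/
def projE (𝒳 : Sec m M) : T.ΓE :=
  ⟨-app T.τ (app 𝒢.φ (app T.τ (app 𝒢.φ 𝒳))), fun x ↦ (T.E x).neg_mem (T.τ_mem _)⟩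

/-- The Levi-Civita derivative `D_a b`, half of the projection of the Koszul section to `E`. -/
def lcD (a b : T.ΓE) : T.ΓE := (1 / 2 : ℝ) • T.projE 𝒢 (𝒢.koszul a.1 b.1)

variable (a b c : T.ΓE) (f : C^∞⟮𝓡 m, M; ℝ⟯) (x : M)

theorem lcD_apply : (T.lcD 𝒢 a b).1 x =
    (1 / 2 : ℝ) • -T.lam 𝒢 x (T.lam 𝒢 x (𝒢.koszul a.1 b.1 x)) := rfl

variable {T 𝒢}

theorem lcD_add_left : T.lcD 𝒢 (a + b) c = T.lcD 𝒢 a c + T.lcD 𝒢 b c := ΓE_ext fun x ↦ by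
  simp only [lcD_apply, Submodule.coe_add, 𝒢.koszul_add_left, ContMDiffSection.coe_add,
    Pi.add_apply, map_add]
  module

theorem lcD_add_right : T.lcD 𝒢 a (b + c) = T.lcD 𝒢 a b + T.lcD 𝒢 a c := ΓE_ext fun x ↦ by
  simp only [lcD_apply, Submodule.coe_add, 𝒢.koszul_add_right, ContMDiffSection.coe_add,
    Pi.add_apply, map_add]
  module

theorem lcD_fsmul_left : T.lcD 𝒢 (T.fsmul f a) b = T.fsmul f (T.lcD 𝒢 a b) := ΓE_ext fun x ↦ by
  rw [fsmul_apply, lcD_apply, lcD_apply, fsmul_coe, 𝒢.koszul_smul_left,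
    T.g_eq_zero (a.2 x) (b.2 x)]
  simp only [map_add, map_sub, map_smul, T.lam_φ_eq_zero 𝒢 (a.2 x), map_zero]
  module

theorem IsCompatible.lcD_fsmul_right (hG : T.IsCompatible 𝒢) :
    (T.lcD 𝒢 a (T.fsmul f b)).1 x = f x • (T.lcD 𝒢 a b).1 x + dirDeriv f (a.1 x).1 • b.1 x := by
  rw [lcD_apply, lcD_apply, fsmul_coe, 𝒢.koszul_smul_right, T.g_eq_zero (a.2 x) (b.2 x)]
  simp only [map_add, map_sub, map_smul, T.lam_φ_eq_zero 𝒢 (b.2 x), map_zero, hG.lam_lam (b.2 x)]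
  module

/-- The Levi-Civita `E`-connection of a generalized metric 2-nilpotent structure. -/
def IsCompatible.leviCivita (hG : T.IsCompatible 𝒢) : T.EConnection where
  D := T.lcD 𝒢
  add_left := lcD_add_left
  smul_left f a b := lcD_fsmul_left a b f
  add_right := lcD_add_right
  leibniz f a b := hG.lcD_fsmul_right a b f

theorem IsCompatible.G_lcD (hG : T.IsCompatible 𝒢) :
    𝒢.G ((T.lcD 𝒢 a b).1 x) (c.1 x) = 1 / 2 * (𝒢.G (courant a.1 b.1 x) (c.1 x)
      + g (courant a.1 (app 𝒢.φ b.1) x) (c.1 x) + g (courant b.1 (app 𝒢.φ a.1) x) (c.1 x)) := by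
  rw [lcD_apply, 𝒢.G_smul_left, hG.G_neg_lam_lam (c.2 x), 𝒢.koszul_apply, 𝒢.G_add_left,
    𝒢.G_add_left]
  simp only [GenRiemannian.G, 𝒢.φ_sq]

theorem g_courant_φ : g (courant a.1 (app 𝒢.φ b.1) x) (c.1 x) =
    dirDeriv (fun y ↦ 𝒢.G (b.1 y) (c.1 y)) (a.1 x).1 - 𝒢.G (courant a.1 c.1 x) (b.1 x)
      - 1 / 2 * dirDeriv (fun y ↦ 𝒢.G (a.1 y) (b.1 y)) (c.1 x).1 := by
  have invariance := dirDeriv_g a.1 (app 𝒢.φ b.1) c.1 x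
  have G_ab : (fun y ↦ g (a.1 y) (app 𝒢.φ b.1 y)) = fun y ↦ 𝒢.G (a.1 y) (b.1 y) :=
    funext fun y ↦ (𝒢.g_φ_left _ _).symm
  have G_bc : (fun y ↦ g (app 𝒢.φ b.1 y) (c.1 y)) = fun y ↦ 𝒢.G (b.1 y) (c.1 y) := rfl
  have G_bracket : g (app 𝒢.φ b.1 x) (courant a.1 c.1 x) = 𝒢.G (courant a.1 c.1 x) (b.1 x) :=
    𝒢.G_comm _ _
  rw [g_section_eq_zero a c, dirDeriv_const, G_ab, G_bc, G_bracket] at invariance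
  linear_combination -invariance

theorem dirDeriv_G_comm (v : TangentSpace (𝓡 m) x) :
    dirDeriv (fun y ↦ 𝒢.G (a.1 y) (b.1 y)) v = dirDeriv (fun y ↦ 𝒢.G (b.1 y) (a.1 y)) v :=
  congrArg (dirDeriv · v) (funext fun _ ↦ 𝒢.G_comm _ _)

theorem IsCompatible.koszul_formula (hG : T.IsCompatible 𝒢) :
    2 * 𝒢.G ((T.lcD 𝒢 a b).1 x) (c.1 x) =
      dirDeriv (fun y ↦ 𝒢.G (b.1 y) (c.1 y)) (a.1 x).1
        + dirDeriv (fun y ↦ 𝒢.G (c.1 y) (a.1 y)) (b.1 x).1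
        - dirDeriv (fun y ↦ 𝒢.G (a.1 y) (b.1 y)) (c.1 x).1
        + 𝒢.G (courant a.1 b.1 x) (c.1 x) - 𝒢.G (courant b.1 c.1 x) (a.1 x)
        + 𝒢.G (courant c.1 a.1 x) (b.1 x) := by
  rw [hG.G_lcD, g_courant_φ a b c, g_courant_φ b a c,
    dirDeriv_G_comm b a x (c.1 x).1, dirDeriv_G_comm c a x (b.1 x).1,
    𝒢.G_courant_swap _ c.1 a.1]
  ring

theorem IsCompatible.lcD_metric (hG : T.IsCompatible 𝒢) :
    dirDeriv (fun y ↦ 𝒢.G (b.1 y) (c.1 y)) (a.1 x).1 =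
      𝒢.G ((T.lcD 𝒢 a b).1 x) (c.1 x) + 𝒢.G (b.1 x) ((T.lcD 𝒢 a c).1 x) := by
  have hbc := hG.koszul_formula a b c x
  have hcb := hG.koszul_formula a c b x
  rw [𝒢.G_courant_swap _ b.1 c.1, 𝒢.G_courant_swap _ c.1 a.1, 𝒢.G_courant_swap _ a.1 b.1,
    dirDeriv_G_comm c b x (a.1 x).1, dirDeriv_G_comm b a x (c.1 x).1,
    dirDeriv_G_comm a c x (b.1 x).1] at hcb
  rw [𝒢.G_comm (b.1 x)]
  linear_combination -1 / 2 * hbc - 1 / 2 * hcb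

theorem IsCompatible.isLeviCivita (hG : T.IsCompatible 𝒢) (hI : T.IsIntegrable) :
    hG.leviCivita.IsLeviCivita 𝒢 where
  metric := hG.lcD_metric
  torsion_free a b x := by
    have koszul_sub : 𝒢.koszul a.1 b.1 x - 𝒢.koszul b.1 a.1 x = (2 : ℝ) • courant a.1 b.1 x := by
      rw [𝒢.koszul_apply, 𝒢.koszul_apply, courant_swap a.1 b.1]
      module
    calc (T.lcD 𝒢 a b).1 x - (T.lcD 𝒢 b a).1 x
        = (1 / 2 : ℝ) • -T.lam 𝒢 x (T.lam 𝒢 x (𝒢.koszul a.1 b.1 x - 𝒢.koszul b.1 a.1 x)) := by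
          rw [lcD_apply, lcD_apply, map_sub, map_sub]
          module
      _ = courant a.1 b.1 x := by
          rw [koszul_sub, map_smul, map_smul, hG.lam_lam (hI.courant_mem a b x hG)]
          module

theorem EConnection.ext_D {D D' : T.EConnection} (h : ∀ a b, D.D a b = D'.D a b) : D = D' := by
  cases D
  cases D'
  congr
  exact funext₂ h

theorem EConnection.IsLeviCivita.unique {D D' : T.EConnection} (h : D.IsLeviCivita 𝒢)
    (h' : D'.IsLeviCivita 𝒢) : D = D' := by
  refine ext_D fun a b ↦ eq_of_G_eq (𝒢 := 𝒢) fun c x ↦ ?_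
  refine eq_zero_of_symm_of_skew
    (S := fun a b c : T.ΓE ↦ 𝒢.G ((D.D a b).1 x - (D'.D a b).1 x) (c.1 x))
    (fun a b c ↦ congrArg (𝒢.G · (c.1 x)) ?_) (fun a b c ↦ ?_) a b c
  · rw [sub_eq_sub_iff_sub_eq_sub, h.torsion_free, h'.torsion_free]
  · have metric := (h.metric a b c x).symm.trans (h'.metric a b c x)
    rw [𝒢.G_comm (b.1 x), 𝒢.G_comm (b.1 x)] at metric
    rw [𝒢.G_sub_left, 𝒢.G_sub_left]
    linear_combination metric

end LeviCivita

section FundamentalForm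

/-- The fundamental 2-form `ω(u, v) = G(λu, v)`. -/
def fundForm {x : M} (u v : Big m M x) : ℝ := 𝒢.G (T.lam 𝒢 x u) v

section Pointwise

variable {x : M} (u v w : Big m M x)

theorem fundForm_swap : T.fundForm 𝒢 u v = -T.fundForm 𝒢 v u := by
  rw [fundForm, G_lam_left, 𝒢.G_comm, fundForm]

theorem fundForm_neg_left : T.fundForm 𝒢 (-u) v = -T.fundForm 𝒢 u v := by
  rw [fundForm, map_neg, 𝒢.G_neg_left, fundForm]

theorem fundForm_sub_left : T.fundForm 𝒢 (u - v) w = T.fundForm 𝒢 u w - T.fundForm 𝒢 v w := by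
  rw [fundForm, map_sub, 𝒢.G_sub_left, fundForm, fundForm]

theorem g_lift (a : T.ΓE) : g (T.lift 𝒢 a x) v = -T.fundForm 𝒢 (a.1 x) v := g_neg_left _ _

end Pointwise

variable {T 𝒢} (a b c : T.ΓE) (x : M)

theorem dirDeriv_fundForm_swap (v : TangentSpace (𝓡 m) x) :
    dirDeriv (fun y ↦ T.fundForm 𝒢 (a.1 y) (b.1 y)) v =
      -dirDeriv (fun y ↦ T.fundForm 𝒢 (b.1 y) (a.1 y)) v := by
  rw [← dirDeriv_neg]
  exact congrArg (dirDeriv · v) (funext fun _ ↦ T.fundForm_swap 𝒢 _ _)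

theorem g_courant_lift : g (courant a.1 (T.lift 𝒢 b) x) (c.1 x) =
    -dirDeriv (fun y ↦ T.fundForm 𝒢 (b.1 y) (c.1 y)) (a.1 x).1
      + T.fundForm 𝒢 (b.1 x) (courant a.1 c.1 x)
      + 1 / 2 * dirDeriv (fun y ↦ T.fundForm 𝒢 (b.1 y) (a.1 y)) (c.1 x).1 := by
  have invariance := dirDeriv_g a.1 (T.lift 𝒢 b) c.1 x
  have g_bc : (fun y ↦ g (T.lift 𝒢 b y) (c.1 y)) = fun y ↦ -T.fundForm 𝒢 (b.1 y) (c.1 y) :=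
    funext fun y ↦ T.g_lift 𝒢 _ b
  have g_ab : (fun y ↦ g (a.1 y) (T.lift 𝒢 b y)) = fun y ↦ -T.fundForm 𝒢 (b.1 y) (a.1 y) :=
    funext fun y ↦ (g_comm _ _).trans (T.g_lift 𝒢 _ b)
  rw [g_section_eq_zero a c, dirDeriv_const, g_bc, g_ab, dirDeriv_neg, dirDeriv_neg,
    T.g_lift 𝒢 _ b] at invariance
  linear_combination -invariance

theorem IsCompatible.fundForm_τ (hG : T.IsCompatible 𝒢) (w : Big m M x) :
    T.fundForm 𝒢 (T.τ x w) (c.1 x) = -g w (c.1 x) := by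
  calc T.fundForm 𝒢 (T.τ x w) (c.1 x)
      = g (T.lift 𝒢 c x) (T.τ x w) := by rw [fundForm_swap, g_lift]
    _ = -g w (c.1 x) := by rw [g_τ_right, hG.τ_lift, g_comm]

theorem IsIntegrable.fundForm_courant (hI : T.IsIntegrable) (hG : T.IsCompatible 𝒢) :
    T.fundForm 𝒢 (courant a.1 b.1 x) (c.1 x) =
      g (courant b.1 (T.lift 𝒢 a) x) (c.1 x) - g (courant a.1 (T.lift 𝒢 b) x) (c.1 x) := by
  rw [hI.courant_eq a b x hG, ← map_add, hG.fundForm_τ, g_add_left, courant_swap b.1, g_neg_left]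
  ring

theorem IsIntegrable.fundForm_closed (hI : T.IsIntegrable) (hG : T.IsCompatible 𝒢) :
    dirDeriv (fun y ↦ T.fundForm 𝒢 (b.1 y) (c.1 y)) (a.1 x).1
      + dirDeriv (fun y ↦ T.fundForm 𝒢 (c.1 y) (a.1 y)) (b.1 x).1
      + dirDeriv (fun y ↦ T.fundForm 𝒢 (a.1 y) (b.1 y)) (c.1 x).1
      - T.fundForm 𝒢 (courant a.1 b.1 x) (c.1 x) - T.fundForm 𝒢 (courant b.1 c.1 x) (a.1 x)
      - T.fundForm 𝒢 (courant c.1 a.1 x) (b.1 x) = 0 := by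
  have hbc := T.fundForm_swap 𝒢 (a.1 x) (courant b.1 c.1 x)
  have hac : T.fundForm 𝒢 (b.1 x) (courant a.1 c.1 x) =
      T.fundForm 𝒢 (courant c.1 a.1 x) (b.1 x) := by
    rw [fundForm_swap, courant_swap c.1 a.1, fundForm_neg_left, neg_neg]
  rw [hI.fundForm_courant a b c x hG, g_courant_lift a b c, g_courant_lift b a c,
    dirDeriv_fundForm_swap a c x (b.1 x).1, dirDeriv_fundForm_swap b a x (c.1 x).1]
  linear_combination hac - hbc

end FundamentalForm

section Kaehler

variable {T 𝒢} {D : T.EConnection} (a b c : T.ΓE) (x : M)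

theorem EConnection.D_neg : D.D a (-b) = -D.D a b :=
  map_neg (AddMonoidHom.mk' (D.D a) (D.add_right a)) b

theorem covLam_apply : (T.covLam 𝒢 D a b).1 x =
    (D.D a (T.lamΓ 𝒢 b)).1 x - T.lam 𝒢 x ((D.D a b).1 x) := rfl

theorem IsCompatible.covLam_lamΓ (hG : T.IsCompatible 𝒢) :
    (T.covLam 𝒢 D a (T.lamΓ 𝒢 b)).1 x = -T.lam 𝒢 x ((T.covLam 𝒢 D a b).1 x) := by
  rw [covLam_apply, covLam_apply, hG.lamΓ_lamΓ, EConnection.D_neg, neg_apply, map_sub,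
    hG.lam_lam ((D.D a b).2 x)]
  abel

theorem IsCompatible.G_covLam_lamΓ (hG : T.IsCompatible 𝒢) :
    𝒢.G ((T.covLam 𝒢 D a (T.lamΓ 𝒢 b)).1 x) (c.1 x) =
      𝒢.G ((T.covLam 𝒢 D a b).1 x) ((T.lamΓ 𝒢 c).1 x) := by
  rw [hG.covLam_lamΓ, 𝒢.G_neg_left, G_lam_left, neg_neg, lamΓ_apply]

namespace EConnection.IsLeviCivita

variable (h : D.IsLeviCivita 𝒢)
include h

theorem G_covLam : 𝒢.G ((T.covLam 𝒢 D a b).1 x) (c.1 x) =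
    dirDeriv (fun y ↦ T.fundForm 𝒢 (b.1 y) (c.1 y)) (a.1 x).1
      - T.fundForm 𝒢 ((D.D a b).1 x) (c.1 x) - T.fundForm 𝒢 (b.1 x) ((D.D a c).1 x) := by
  have metric : dirDeriv (fun y ↦ T.fundForm 𝒢 (b.1 y) (c.1 y)) (a.1 x).1 =
      𝒢.G ((D.D a (T.lamΓ 𝒢 b)).1 x) (c.1 x) + T.fundForm 𝒢 (b.1 x) ((D.D a c).1 x) :=
    h.metric a (T.lamΓ 𝒢 b) c x
  rw [covLam_apply, 𝒢.G_sub_left, metric, ← fundForm]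
  ring

theorem G_covLam_skew : 𝒢.G ((T.covLam 𝒢 D a b).1 x) (c.1 x) =
    -𝒢.G ((T.covLam 𝒢 D a c).1 x) (b.1 x) := by
  rw [h.G_covLam a b c, h.G_covLam a c b, dirDeriv_fundForm_swap c b x (a.1 x).1,
    T.fundForm_swap 𝒢 ((D.D a c).1 x) (b.1 x), T.fundForm_swap 𝒢 (c.1 x) ((D.D a b).1 x)]
  ring

theorem fundForm_courant : T.fundForm 𝒢 (courant a.1 b.1 x) (c.1 x) =
    T.fundForm 𝒢 ((D.D a b).1 x) (c.1 x) + T.fundForm 𝒢 (c.1 x) ((D.D b a).1 x) := by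
  rw [← h.torsion_free a b x, fundForm_sub_left, T.fundForm_swap 𝒢 (c.1 x), sub_eq_add_neg]

theorem G_covLam_cyclic (hG : T.IsCompatible 𝒢) (hI : T.IsIntegrable) :
    𝒢.G ((T.covLam 𝒢 D a b).1 x) (c.1 x) + 𝒢.G ((T.covLam 𝒢 D b c).1 x) (a.1 x)
      + 𝒢.G ((T.covLam 𝒢 D c a).1 x) (b.1 x) = 0 := by
  have closed := hI.fundForm_closed a b c x hG
  rw [h.fundForm_courant a b c, h.fundForm_courant b c a, h.fundForm_courant c a b] at closed
  rw [h.G_covLam a b c, h.G_covLam b c a, h.G_covLam c a b]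
  linear_combination closed

theorem nijenhuis_eq : T.nijenhuis 𝒢 a b x =
    (T.covLam 𝒢 D (T.lamΓ 𝒢 a) b).1 x - (T.covLam 𝒢 D (T.lamΓ 𝒢 b) a).1 x
      - T.lam 𝒢 x ((T.covLam 𝒢 D a b).1 x) + T.lam 𝒢 x ((T.covLam 𝒢 D b a).1 x) := by
  rw [nijenhuis, ← h.torsion_free, ← h.torsion_free, ← h.torsion_free, ← h.torsion_free]
  simp only [covLam_apply, map_sub, lam, ContinuousLinearMap.comp_apply]
  abel

theorem G_nijenhuis : 𝒢.G (T.nijenhuis 𝒢 a b x) (c.1 x) =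
    𝒢.G ((T.covLam 𝒢 D (T.lamΓ 𝒢 a) b).1 x) (c.1 x)
      - 𝒢.G ((T.covLam 𝒢 D (T.lamΓ 𝒢 b) a).1 x) (c.1 x)
      + 𝒢.G ((T.covLam 𝒢 D a b).1 x) ((T.lamΓ 𝒢 c).1 x)
      - 𝒢.G ((T.covLam 𝒢 D b a).1 x) ((T.lamΓ 𝒢 c).1 x) := by
  rw [h.nijenhuis_eq, 𝒢.G_add_left, 𝒢.G_sub_left, 𝒢.G_sub_left, G_lam_left, G_lam_left,
    lamΓ_apply]
  ring

theorem covLam_eq_zero (hG : T.IsCompatible 𝒢) (hI : T.IsIntegrable) (hK : T.IsKahlerType 𝒢) :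
    T.covLam 𝒢 D a b = 0 := by
  refine ΓE_ext fun x ↦ 𝒢.eq_zero_of_G_self ?_
  refine eq_zero_of_kaehler_identities (J := T.lamΓ 𝒢)
    (S := fun a b c ↦ 𝒢.G ((T.covLam 𝒢 D a b).1 x) (c.1 x))
    (fun a b c ↦ h.G_covLam_skew a b c x) (fun a b c ↦ hG.G_covLam_lamΓ a b c x)
    (fun a b c ↦ ?_) (fun a b c ↦ h.G_covLam_cyclic a b c x hG hI) (fun a b c ↦ ?_)
    a b (T.covLam 𝒢 D a b)
  · rw [hG.lamΓ_lamΓ, neg_apply, 𝒢.G_comm, 𝒢.G_neg_left, 𝒢.G_comm]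
  · rw [← h.G_nijenhuis, hK, 𝒢.G_zero_left]

theorem isKahlerType_iff (hG : T.IsCompatible 𝒢) (hI : T.IsIntegrable) :
    T.IsKahlerType 𝒢 ↔ ∀ a b : T.ΓE, T.covLam 𝒢 D a b = 0 := by
  refine ⟨fun hK a b ↦ h.covLam_eq_zero a b hG hI hK, fun parallel a b x ↦ ?_⟩
  have covLam_zero (a b : T.ΓE) : (T.covLam 𝒢 D a b).1 x = 0 :=
    congrArg (fun e : T.ΓE ↦ e.1 x) (parallel a b)
  rw [h.nijenhuis_eq, covLam_zero, covLam_zero, covLam_zero, covLam_zero, map_zero, sub_zero,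
    sub_zero, add_zero]

end EConnection.IsLeviCivita

end Kaehler

end TwoNilpotent

end BigTangent

end

theorem proposition5p3_general {m : ℕ} {M : Type*} [TopologicalSpace M]
    [ChartedSpace (EuclideanSpace ℝ (Fin m)) M] [IsManifold (𝓡 m) ∞ M]
    (𝒢 : BigTangent.GenRiemannian m M) (T : BigTangent.TwoNilpotent m M)
    (hG : T.IsCompatible 𝒢) (hI : T.IsIntegrable) :
    ∃ D : T.EConnection, D.IsLeviCivita 𝒢 ∧
      (∀ D' : T.EConnection, D'.IsLeviCivita 𝒢 → D' = D) ∧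
      (T.IsKahlerType 𝒢 ↔ ∀ a b : T.ΓE, T.covLam 𝒢 D a b = 0) :=
  have leviCivita := hG.isLeviCivita hI
  ⟨hG.leviCivita, leviCivita, fun _ h ↦ h.unique leviCivita, leviCivita.isKahlerType_iff hG hI⟩

theorem proposition5p3 {m : ℕ} {M : Type*} [TopologicalSpace M] [T2Space M]
    [ChartedSpace (EuclideanSpace ℝ (Fin m)) M] [IsManifold (𝓡 m) ∞ M]
    (𝒢 : BigTangent.GenRiemannian m M) (T : BigTangent.TwoNilpotent m M)
    (hG : T.IsCompatible 𝒢) (hI : T.IsIntegrable) :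
    ∃ D : T.EConnection, D.IsLeviCivita 𝒢 ∧
      (∀ D' : T.EConnection, D'.IsLeviCivita 𝒢 → D' = D) ∧
      (T.IsKahlerType 𝒢 ↔ ∀ a b : T.ΓE, T.covLam 𝒢 D a b = 0) :=
  proposition5p3_general 𝒢 T hG hI
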